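/- Fix integers $L\ge 1$, $r\ge 1$, filter sizes $k_0,\dots,k_{L-1}\ge 1$, strides $s_0,\dots,s_{L-1}\ge 1$ and dimensions $d_0,\dots,d_L\ge 1$ with $d_i=s_i(d_{i+1}-1)+k_i$ for $0\le i<L$. For a filter $w\in\mathbb{R}^{k}$, a stride $s$ and $x\in\mathbb{R}^{d}$ with $d=s(d'-1)+k$, let $w\star_s x\in\mathbb{R}^{d'}$ be given by $(w\star_s x)[i]=\sum_{0\le j<k}w[j]\,x[si+j]$, and let $\sigma_r(t)=t^r$, applied coordinate-wise. For $\mathbf{w}=(w_0,\dots,w_{L-1})\in\bigoplus_i\mathbb{R}^{k_i}$ let $$\varphi_{\mathbf w}(x)=w_{L-1}\star_{s_{L-1}}\sigma_r\bigl(\cdots\star_{s_1}\sigma_r(w_0\star_{s_0}x)\bigr),\qquad x\in\mathbb{R}^{d_0}.$$ It is regarded as an element of $V=\mathrm{Sym}_{r^{L-1}}(\mathbb{R}^{d_0})^{d_L}$, the space of $d_L$-tuples of real homogeneous polynomials of degree $r^{L-1}$ in $d_0$ variables. The neuromanifold is $\mathcal{M}_{\mathbf d,\mathbf k,\mathbf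 s,r}=\{\varphi_{\mathbf w}\}\subseteq V$. If all $w_i$ are non-zero, then $\varphi_{\mathbf w}\neq 0$, and the projective neuromanifold $\mathbb{P}\mathcal{M}_{\mathbf d,\mathbf k,\mathbf s,r}\subseteq\mathbb{P}V$ is the image of the map $\overline{\varphi}:\prod_{i}\mathbb{P}\mathbb{R}^{k_i}\to\mathbb{P}V$, $([w_i])_i\mapsto[\varphi_{\mathbf w}]$. If $r>1$, then $\mathbb{P}\mathcal{M}_{\mathbf d,\mathbf k,\mathbf s,r}$ and $\mathcal{M}_{\mathbf d,\mathbf k,\mathbf s,r}$ are closed in the real Zariski topologies of $\mathbb{P}V$ and $V$ respectively, i.e. they are the common zero loci of a set of real homogeneous polynomials on $V$ and of a set of real polynomials on $V$, respectively; so they are real algebraic varieties. This fails for linear networks: there are $L,\mathbf d,\mathbf k,\mathbf s$ such that, for $r=1$, neither $\mathbb{P}\mathcal{M}_{\mathbf d,\mathbf k,\mathbf s,1}$ nor $\mathcal{M}_{\mathbf d,\mathbf k,\mathbf s,1}$ is Zariski closed. -/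

import Mathlib

open MvPolynomial
open scoped LinearAlgebra.Projectivization Topology

noncomputable section

/-! ### Zariski topologies on a vector space and on its projectification -/

section Zariski

variable (K V : Type*) [Field K] [AddCommGroup V] [Module K V]

/-- Value at `v : V` of a polynomial expression `p` in linear functionals on `V`. The functions
`v ↦ polyValue p v` are exactly the polynomial functions on `V` (the coordinate functions of any
basis are linear functionals); those with `p` homogeneous of degree `n` are the homogeneous ones
of degree `n`. -/
def polyValue {K V : Type*} [Field K] [AddCommGroup V] [Module K V]
    (p : MvPolynomial (Module.Dual K V) K) (v : V) : K :=
  eval (fun l : Module.Dual K V => l v) p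

/-- The Zariski topology of a vector space: the closed sets are the common zero loci of
polynomials. -/
@[reducible]
def affineZariskiTopology : TopologicalSpace V :=
  TopologicalSpace.ofClosed
    {S : Set V | ∃ P : Set (MvPolynomial (Module.Dual K V) K),
      S = {v | ∀ p ∈ P, polyValue p v = 0}}
    ⟨{1}, by ext v; simp [polyValue]⟩
    (by
      intro A hA
      choose P hP using hA
      refine ⟨⋃ S, ⋃ hS : S ∈ A, P hS, ?_⟩
      ext v
      simp only [Set.mem_sInter, Set.mem_iUnion, Set.mem_ofPred_eq]
      constructor
      · rintro h p ⟨S, hS, hp⟩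
        have hv := h S hS
        rw [hP hS] at hv
        exact hv p hp
      · intro h S hS
        rw [hP hS]
        exact fun p hp => h p ⟨S, hS, hp⟩)
    (by
      rintro _ ⟨P, rfl⟩ _ ⟨Q, rfl⟩
      refine ⟨{f | ∃ p ∈ P, ∃ q ∈ Q, f = p * q}, ?_⟩
      ext v
      simp only [Set.mem_union, Set.mem_ofPred_eq]
      constructor
      · rintro (h | h) _ ⟨p, hp, q, hq, rfl⟩
        · have := h p hp
          simp_all [polyValue]
        · have := h q hq
          simp_all [polyValue]
      · intro h
        by_contra! hne
        obtain ⟨⟨p, hp, hpv⟩, q, hq, hqv⟩ := hne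
        have := h _ ⟨p, hp, q, hq, rfl⟩
        simp_all [polyValue])

/-- The Zariski topology of the projective space `ℙ K V`: the closed sets are the common zero
loci of homogeneous polynomials. -/
@[reducible]
def projectiveZariskiTopology : TopologicalSpace (ℙ K V) :=
  TopologicalSpace.ofClosed
    {S : Set (ℙ K V) | ∃ P : Set (MvPolynomial (Module.Dual K V) K),
      (∀ p ∈ P, ∃ n : ℕ, p.IsHomogeneous n) ∧
      S = {x | ∀ v : V, ∀ hv : v ≠ 0, x = Projectivization.mk K v hv →
        ∀ p ∈ P, polyValue p v = 0}}
    ⟨{1}, by simpa using ⟨0, isHomogeneous_one _ _⟩, by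
      ext x
      simpa [polyValue] using ⟨x.rep, x.rep_nonzero, (x.mk_rep).symm⟩⟩
    (by
      intro A hA
      choose P hom hP using hA
      refine ⟨⋃ S, ⋃ hS : S ∈ A, P hS, ?_, ?_⟩
      · intro p hp
        simp only [Set.mem_iUnion] at hp
        obtain ⟨S, hS, hp⟩ := hp
        exact hom hS p hp
      ext x
      simp only [Set.mem_sInter, Set.mem_iUnion, Set.mem_ofPred_eq]
      constructor
      · rintro h v hv hx p ⟨S, hS, hp⟩
        have hxS := h S hS
        rw [hP hS] at hxS
        exact hxS v hv hx p hp
      · intro h S hS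
        rw [hP hS]
        exact fun v hv hx p hp => h v hv hx p ⟨S, hS, hp⟩)
    (by
      rintro _ ⟨P, homP, rfl⟩ _ ⟨Q, homQ, rfl⟩
      refine ⟨{f | ∃ p ∈ P, ∃ q ∈ Q, f = p * q}, ?_, ?_⟩
      · rintro _ ⟨p, hp, q, hq, rfl⟩
        obtain ⟨m, hm⟩ := homP p hp
        obtain ⟨n, hn⟩ := homQ q hq
        exact ⟨m + n, hm.mul hn⟩
      ext x
      simp only [Set.mem_union, Set.mem_ofPred_eq]
      constructor
      · rintro (h | h) v hv hx _ ⟨p, hp, q, hq, rfl⟩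
        · have := h v hv hx p hp
          simp_all [polyValue]
        · have := h v hv hx q hq
          simp_all [polyValue]
      · intro h
        by_contra! hne
        obtain ⟨⟨v, hv, hxv, p, hp, hpv⟩, u, hu, hxu, q, hq, hqu⟩ := hne
        -- homogeneity: not vanishing does not depend on the representative
        obtain ⟨c, hc⟩ := (Projectivization.mk_eq_mk_iff' K v u hv hu).1 (hxv.symm.trans hxu)
        have hqv : polyValue q v ≠ 0 := by
          intro h0
          obtain ⟨n, hn⟩ := homQ q hq
          have hc0 : c ≠ 0 := by rintro rfl; exact hv (by simpa using hc.symm)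
          apply hqu
          have hs : polyValue q v = c ^ n * polyValue q u := by
            have hvu : (fun l : Module.Dual K V => l v) = fun l => c * l u := by
              ext l
              rw [← hc, map_smul, smul_eq_mul]
            rw [polyValue, hvu, polyValue, eval_eq, eval_eq, Finset.mul_sum]
            refine Finset.sum_congr rfl fun e he => ?_
            have hdeg : ∑ i ∈ e.support, e i = n := by
              rw [← hn (mem_support_iff.1 he)]
              exact DFunLike.congr_fun Finsupp.degree_eq_weight_one e
            simp only [mul_pow, Finset.prod_mul_distrib, Finset.prod_pow_eq_pow_sum, hdeg]
            ring
          rw [h0] at hs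
          simpa [hc0] using hs.symm
        have := h v hv hxv _ ⟨p, hp, q, hq, rfl⟩
        simp_all [polyValue])

end Zariski

/-! ### Convolutional networks with monomial activation -/

/-- The convolution of stride `s` of a filter `w` of size `k` with a vector `x` of length
`d = s (d' - 1) + k`: the vector of length `d'` with `i`-th entry `∑ j, w[j] x[s i + j]`.
The entries of `x` lie in an `R`-algebra `A`, so that `x` may be a vector of numbers or the vector
of the variables of a polynomial ring. -/
def conv {R A : Type*} [CommSemiring R] [CommSemiring A] [Algebra R A] {k s d d' : ℕ}
    (hd : d = s * (d' - 1) + k) (w : Fin k → R) (x : Fin d → A) : Fin d' → A :=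
  fun i => ∑ j : Fin k, w j • x ⟨s * i + j, by
    have h1 : s * (i : ℕ) ≤ s * (d' - 1) := Nat.mul_le_mul_left s (by have := i.2; omega)
    have h2 := j.2
    omega⟩

/-- The hyperparameters of a polynomial convolutional network. -/
structure PolyCNN where
  /-- number of layers -/
  L : ℕ
  /-- filter sizes -/
  k : Fin L → ℕ
  /-- strides -/
  s : Fin L → ℕ
  /-- dimensions of the layers -/
  d : Fin (L + 1) → ℕ
  /-- activation degree: the activation function is `t ↦ t ^ r` -/
  r : ℕ
  L_pos : 0 < L
  k_pos : ∀ i, 0 < k i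
  s_pos : ∀ i, 0 < s i
  r_pos : 0 < r
  d_last_pos : 0 < d (Fin.last L)
  d_eq : ∀ i : Fin L, d i.castSucc = s i * (d i.succ - 1) + k i

namespace PolyCNN

variable (N : PolyCNN)

/-- The weights: one filter for each layer. -/
abbrev Weights (R : Type*) : Type _ := (i : Fin N.L) → Fin (N.k i) → R

/-- The output of the first `n` layers, without activation after the `n`-th one:
`z₀ = x`, `z₁ = w₀ ⋆ x` and `zₙ₊₂ = wₙ₊₁ ⋆ σ(zₙ₊₁)`. -/
def feature {R A : Type*} [CommSemiring R] [CommSemiring A] [Algebra R A]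
    (w : N.Weights R) (x : Fin (N.d 0) → A) :
    (n : ℕ) → (h : n ≤ N.L) → Fin (N.d ⟨n, Nat.lt_succ_of_le h⟩) → A
  | 0, _ => x
  | 1, h => conv (N.d_eq ⟨0, h⟩) (w ⟨0, h⟩) x
  | n + 2, h => conv (N.d_eq ⟨n + 1, h⟩) (w ⟨n + 1, h⟩)
      (fun i => feature w x (n + 1) (Nat.le_of_succ_le h) i ^ N.r)

/-- The network `φ_w`, as a map `A ^ d₀ → A ^ d_L`. -/
def net {R A : Type*} [CommSemiring R] [CommSemiring A] [Algebra R A]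
    (w : N.Weights R) (x : Fin (N.d 0) → A) : Fin (N.d (Fin.last N.L)) → A :=
  N.feature w x N.L le_rfl

/-- The ambient space `Sym_{r^(L-1)}(ℝ^{d₀})^{d_L}`: tuples of `d_L` homogeneous polynomials of
degree `r ^ (L - 1)` in `d₀` variables. -/
abbrev Ambient : Type :=
  Fin (N.d (Fin.last N.L)) → homogeneousSubmodule (Fin (N.d 0)) ℝ (N.r ^ (N.L - 1))

theorem conv_isHomogeneous {σ : Type*} {k s d d' m : ℕ} (hd : d = s * (d' - 1) + k)
    (w : Fin k → ℝ) (x : Fin d → MvPolynomial σ ℝ) (hx : ∀ i, (x i).IsHomogeneous m)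
    (i : Fin d') : (conv hd w x i).IsHomogeneous m :=
  (mem_homogeneousSubmodule m _).1 <| Submodule.sum_mem _ fun _ _ =>
    Submodule.smul_mem _ _ ((mem_homogeneousSubmodule m _).2 (hx _))

theorem feature_isHomogeneous (w : N.Weights ℝ) : ∀ (n : ℕ) (h : n ≤ N.L) (i : Fin _),
    (N.feature w (X : Fin (N.d 0) → MvPolynomial (Fin (N.d 0)) ℝ) n h i).IsHomogeneous
      (N.r ^ (n - 1))
  | 0, _, i => by simpa [feature] using isHomogeneous_X ℝ i
  | 1, h, i => by
      rw [feature]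
      exact conv_isHomogeneous _ _ _ (fun i => by simpa using isHomogeneous_X ℝ i) i
  | n + 2, h, i => by
      rw [feature]
      refine conv_isHomogeneous _ _ _ (fun i => ?_) i
      have := (feature_isHomogeneous w (n + 1) (Nat.le_of_succ_le h) i).pow N.r
      simpa [pow_succ] using this

/-- The parametrization `w ↦ φ_w`, with `φ_w` regarded as a tuple of homogeneous polynomials:
the network applied to the vector of variables. -/
def param (w : N.Weights ℝ) : N.Ambient := fun i =>
  ⟨N.net w (X : Fin (N.d 0) → MvPolynomial (Fin (N.d 0)) ℝ) i,
    N.feature_isHomogeneous w N.L le_rfl i⟩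

theorem map_feature {R A B : Type*} [CommSemiring R] [CommSemiring A] [Algebra R A]
    [CommSemiring B] [Algebra R B] (f : A →ₐ[R] B) (w : N.Weights R) (x : Fin (N.d 0) → A) :
    ∀ (n : ℕ) (h : n ≤ N.L) (i : Fin _),
      f (N.feature w x n h i) = N.feature w (fun j => f (x j)) n h i
  | 0, _, _ => rfl
  | 1, _, _ => by simp [feature, conv]
  | n + 2, h, i => by simp [feature, conv, map_feature f w x (n + 1)]

/-- The tuple of polynomials `param w` defines the function `φ_w : ℝ^{d₀} → ℝ^{d_L}`. -/
theorem eval_param (w : N.Weights ℝ) (x : Fin (N.d 0) → ℝ) (i : Fin (N.d (Fin.last N.L))) :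
    eval x (N.param w i : MvPolynomial (Fin (N.d 0)) ℝ) = N.net w x i := by
  have := N.map_feature (aeval x : MvPolynomial (Fin (N.d 0)) ℝ →ₐ[ℝ] ℝ) w X N.L le_rfl i
  simpa [param, net, aeval_eq_eval] using this

/-- A convolution with a non-zero filter carries some vectors with first non-zero entry at a
prescribed position to vectors with the same property. -/
theorem exists_conv_pivot {k s d d' : ℕ} (hd : d = s * (d' - 1) + k) (hs : 0 < s)
    (w : Fin k → ℝ) (hw : w ≠ 0) (q : Fin d') : ∃ p : Fin d, ∀ z : Fin d → ℝ,
      (∀ t < p, z t = 0) → z p ≠ 0 → (∀ t < q, conv hd w z t = 0) ∧ conv hd w z q ≠ 0 := by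
  classical
  obtain ⟨j₀, hj₀⟩ := Function.ne_iff.1 hw
  obtain ⟨m, hm, hmax⟩ := (Finset.univ.filter fun j => w j ≠ 0).exists_max_image id
    ⟨j₀, by simpa using hj₀⟩
  simp only [Finset.mem_filter, Finset.mem_univ, true_and, id] at hm hmax
  have h1 : s * (q : ℕ) ≤ s * (d' - 1) := Nat.mul_le_mul_left s (by have := q.2; omega)
  refine ⟨⟨s * q + m, by have := m.2; omega⟩, fun z hz hzp => ⟨fun t ht => ?_, ?_⟩⟩
  · refine Finset.sum_eq_zero fun j _ => ?_
    by_cases hj : w j = 0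
    · simp [hj]
    · rw [hz _ ?_, smul_zero]
      have h2 : s * (t : ℕ) < s * (q : ℕ) := Nat.mul_lt_mul_of_pos_left ht hs
      have h3 : (j : ℕ) ≤ m := hmax j hj
      rw [Fin.lt_def]
      dsimp only
      omega
  · have : conv hd w z q = w m * z ⟨s * q + m, by have := m.2; omega⟩ := by
      refine Finset.sum_eq_single m (fun j _ hjm => ?_) (by simp)
      by_cases hj : w j = 0
      · simp [hj]
      · rw [hz _ ?_, smul_zero]
        have h3 : j < m := lt_of_le_of_ne (hmax j hj) hjm
        rw [Fin.lt_def] at h3 ⊢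
        dsimp only
        omega
    rw [this]
    exact mul_ne_zero hm hzp

theorem exists_pivot {n : ℕ} (q : Fin n) : ∃ x : Fin n → ℝ, (∀ t < q, x t = 0) ∧ x q ≠ 0 :=
  ⟨fun t => if t = q then 1 else 0, fun t ht => by simp [ht.ne], by simp⟩

theorem exists_feature_pivot (w : N.Weights ℝ) (hw : ∀ i, w i ≠ 0) :
    ∀ (n : ℕ) (h : n ≤ N.L) (q : Fin (N.d ⟨n, Nat.lt_succ_of_le h⟩)),
      ∃ x : Fin (N.d 0) → ℝ, (∀ t < q, N.feature w x n h t = 0) ∧ N.feature w x n h q ≠ 0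
  | 0, _, q => exists_pivot q
  | 1, h, q => by
      obtain ⟨p, hp⟩ := exists_conv_pivot (N.d_eq ⟨0, h⟩) (N.s_pos _) _ (hw ⟨0, h⟩) q
      obtain ⟨x, hx0, hx⟩ := exists_pivot p
      exact ⟨x, hp x hx0 hx⟩
  | n + 2, h, q => by
      obtain ⟨p, hp⟩ := exists_conv_pivot (N.d_eq ⟨n + 1, h⟩) (N.s_pos _) _ (hw ⟨n + 1, h⟩) q
      obtain ⟨x, hx0, hx⟩ := exists_feature_pivot w hw (n + 1) (Nat.le_of_succ_le h) p
      exact ⟨x, hp _ (fun t ht => by simp [hx0 t ht, N.r_pos.ne']) (pow_ne_zero _ hx)⟩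

/-- If no filter vanishes, then the network does not vanish. -/
theorem param_ne_zero (w : N.Weights ℝ) (hw : ∀ i, w i ≠ 0) : N.param w ≠ 0 := by
  intro h0
  obtain ⟨x, -, hx⟩ := N.exists_feature_pivot w hw N.L le_rfl ⟨0, N.d_last_pos⟩
  apply hx
  have := N.eval_param w x ⟨0, N.d_last_pos⟩
  rw [h0] at this
  simpa [net] using this.symm

/-- The neuromanifold: the image of the parametrization. -/
def neuromanifold : Set N.Ambient := Set.range N.param

/-- The projectified parametrization `∏ᵢ ℙ(ℝ^{kᵢ}) → ℙ(Sym_{r^(L-1)}(ℝ^{d₀})^{d_L})`,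
`([wᵢ])ᵢ ↦ [φ_w]`. -/
def projParam (w : (i : Fin N.L) → ℙ ℝ (Fin (N.k i) → ℝ)) : ℙ ℝ N.Ambient :=
  Projectivization.mk ℝ (N.param fun i => (w i).rep)
    (N.param_ne_zero _ fun i => (w i).rep_nonzero)

theorem feature_rescale (w v : N.Weights ℝ) (c : Fin N.L → ℝ) (hc : ∀ i, c i ≠ 0)
    (hwv : ∀ i, v i = c i • w i) {A : Type*} [CommSemiring A] [Algebra ℝ A]
    (x : Fin (N.d 0) → A) : ∀ (n : ℕ) (h : n ≤ N.L),
      ∃ b : ℝ, b ≠ 0 ∧ N.feature v x n h = b • N.feature w x n h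
  | 0, _ => ⟨1, one_ne_zero, (one_smul ℝ x).symm⟩
  | 1, h => ⟨c ⟨0, h⟩, hc _, by
      ext i
      simp [feature, conv, hwv, Finset.smul_sum, mul_smul]⟩
  | n + 2, h => by
      obtain ⟨b, hb, hbw⟩ := feature_rescale w v c hc hwv x (n + 1) (Nat.le_of_succ_le h)
      refine ⟨c ⟨n + 1, h⟩ * b ^ N.r, mul_ne_zero (hc _) (pow_ne_zero _ hb), ?_⟩
      ext i
      simp only [feature, conv, hbw, hwv, Pi.smul_apply, smul_pow, Finset.smul_sum, smul_smul,
        smul_eq_mul]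
      exact Finset.sum_congr rfl fun j _ => by congr 1; ring

/-- The projectified parametrization does not depend on the chosen representatives. -/
theorem projParam_mk (w : N.Weights ℝ) (hw : ∀ i, w i ≠ 0) :
    N.projParam (fun i => Projectivization.mk ℝ (w i) (hw i)) =
      Projectivization.mk ℝ (N.param w) (N.param_ne_zero w hw) := by
  choose c hc using fun i => Projectivization.exists_smul_eq_mk_rep ℝ (w i) (hw i)
  obtain ⟨b, -, hbw⟩ := N.feature_rescale w
    (fun i => (Projectivization.mk ℝ (w i) (hw i)).rep) (fun i => (c i : ℝ))
    (fun i => (c i).ne_zero) (fun i => (hc i).symm)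
    (X : Fin (N.d 0) → MvPolynomial (Fin (N.d 0)) ℝ) N.L le_rfl
  rw [projParam, Projectivization.mk_eq_mk_iff']
  refine ⟨b, ?_⟩
  ext1 i
  exact Subtype.ext (congrFun hbw i).symm

/-- The projective neuromanifold: the image of the projectified parametrization. -/
def projNeuromanifold : Set (ℙ ℝ N.Ambient) := Set.range N.projParam

end PolyCNN

end

noncomputable section

/-! ### Polynomials with coefficients in a subfield -/

/-- The polynomials all of whose coefficients lie in a given subfield. -/
def coeffSubring {K : Type*} [Field K] (σ : Type*) (k : Subfield K) :
    Subring (MvPolynomial σ K) where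
  carrier := {f | ∀ m, coeff m f ∈ k}
  mul_mem' {f g} hf hg m := by
    classical
    rw [coeff_mul]
    exact sum_mem fun x _ => mul_mem (hf _) (hg _)
  one_mem' m := by
    classical
    rw [coeff_one]
    split_ifs
    exacts [one_mem _, zero_mem _]
  add_mem' {f g} hf hg m := by
    rw [coeff_add]
    exact add_mem (hf m) (hg m)
  zero_mem' m := by
    rw [coeff_zero]
    exact zero_mem _
  neg_mem' {f} hf m := by
    rw [coeff_neg]
    exact neg_mem (hf m)

section Coeffs

variable {K σ : Type*} [Field K] {k : Subfield K}

theorem X_mem_coeffSubring (i : σ) : (X i : MvPolynomial σ K) ∈ coeffSubring σ k := fun m => by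
  classical
  rw [coeff_X]
  split_ifs
  exacts [one_mem _, zero_mem _]

theorem smul_mem_coeffSubring {c : K} (hc : c ∈ k) {f : MvPolynomial σ K}
    (hf : f ∈ coeffSubring σ k) : c • f ∈ coeffSubring σ k := fun m => by
  rw [coeff_smul]
  exact mul_mem hc (hf m)

/-- A linear combination of polynomials over a subfield that are in triangular position lies
over the subfield only if its coefficients do. -/
theorem coeff_mem_of_sum_mem {q : ℕ} {y : Fin q → MvPolynomial σ K}
    (hy : ∀ j, y j ∈ coeffSubring σ k) (μ : Fin q → σ →₀ ℕ) (hμ : ∀ j, coeff (μ j) (y j) ≠ 0)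
    (hμ' : ∀ j j', j < j' → coeff (μ j) (y j') = 0) (u : Fin q → K)
    (hu : ∑ j, u j • y j ∈ coeffSubring σ k) (j : Fin q) : u j ∈ k := by
  induction j using WellFoundedLT.induction with
  | ind j ih =>
    -- At the monomial `μ j`, the terms after `j` vanish and those before `j` lie in `k` by
    -- induction.
    have h := hu (μ j)
    simp only [coeff_sum, coeff_smul, smul_eq_mul] at h
    rw [← Finset.add_sum_erase _ _ (Finset.mem_univ j)] at h
    have h2 : ∑ i ∈ Finset.univ.erase j, u i * coeff (μ j) (y i) ∈ k := by
      refine sum_mem fun i hi => ?_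
      rcases lt_or_gt_of_ne (Finset.ne_of_mem_erase hi) with hij | hij
      · exact mul_mem (ih i hij) (hy i _)
      · rw [hμ' j i hij, mul_zero]
        exact zero_mem _
    have h3 := div_mem ((add_mem_cancel_right h2).1 h) (hy j (μ j))
    rwa [mul_div_cancel_right₀ _ (hμ j)] at h3

end Coeffs

/-! ### First variables -/

/-- `t` is the first variable that occurs in `f`. -/
def IsFirstVar {K σ : Type*} [CommSemiring K] [LT σ] (f : MvPolynomial σ K) (t : σ) : Prop :=
  degreeOf t f ≠ 0 ∧ ∀ s < t, degreeOf s f = 0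

section FirstVar

variable {K σ : Type*} [Field K]

theorem degreeOf_eq_zero_iff_coeff {f : MvPolynomial σ K} {t : σ} :
    degreeOf t f = 0 ↔ ∀ μ : σ →₀ ℕ, μ t ≠ 0 → coeff μ f = 0 := by
  rw [← Nat.le_zero, degreeOf_le_iff]
  refine forall_congr' fun μ => ?_
  rw [mem_support_iff, Nat.le_zero]
  tauto

theorem IsFirstVar.ne_zero [LT σ] {f : MvPolynomial σ K} {t : σ} (h : IsFirstVar f t) :
    f ≠ 0 := by
  rintro rfl
  exact h.1 (by simp)

theorem IsFirstVar.pow [LT σ] {f : MvPolynomial σ K} {t : σ} (h : IsFirstVar f t) {r : ℕ}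
    (hr : 0 < r) : IsFirstVar (f ^ r) t := by
  refine ⟨?_, fun s hs => ?_⟩
  · rw [degreeOf_pow_eq _ _ _ h.ne_zero]
    exact mul_ne_zero hr.ne' h.1
  · rw [degreeOf_pow_eq _ _ _ h.ne_zero, h.2 s hs, mul_zero]

theorem isFirstVar_X [LinearOrder σ] (i : σ) : IsFirstVar (X i : MvPolynomial σ K) i := by
  classical
  refine ⟨by simp, fun s hs => ?_⟩
  simp [degreeOf_X, hs.ne]

theorem IsFirstVar.exists_coeff_ne_zero [LT σ] {f : MvPolynomial σ K} {t : σ}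
    (h : IsFirstVar f t) : ∃ μ : σ →₀ ℕ, μ t ≠ 0 ∧ coeff μ f ≠ 0 := by
  have := h.1
  rw [Ne, degreeOf_eq_zero_iff_coeff] at this
  push Not at this
  exact this

theorem degreeOf_sum_eq_zero {ι : Type*} {s : Finset ι} {f : ι → MvPolynomial σ K} {t : σ}
    (h : ∀ i ∈ s, degreeOf t (f i) = 0) : degreeOf t (∑ i ∈ s, f i) = 0 := by
  rw [degreeOf_eq_zero_iff_coeff]
  intro μ hμ
  rw [coeff_sum]
  exact Finset.sum_eq_zero fun i hi => degreeOf_eq_zero_iff_coeff.1 (h i hi) μ hμ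

theorem degreeOf_smul_eq_zero {f : MvPolynomial σ K} {t : σ} (c : K)
    (h : degreeOf t f = 0) : degreeOf t (c • f) = 0 := by
  rw [degreeOf_eq_zero_iff_coeff] at h ⊢
  intro μ hμ
  rw [coeff_smul, h μ hμ, smul_zero]

/-- The lexicographic leading monomial contains the first variable. -/
theorem IsFirstVar.degree_lex_ne_zero {n : ℕ} {f : MvPolynomial (Fin n) K} {t : Fin n}
    (h : IsFirstVar f t) : (MonomialOrder.lex (σ := Fin n)).degree f t ≠ 0 := by
  obtain ⟨μ, hμt, hμ⟩ := h.exists_coeff_ne_zero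
  intro h0
  have hle := (MonomialOrder.lex (σ := Fin n)).le_degree (mem_support_iff.2 hμ)
  refine not_lt_of_ge hle ?_
  -- No variable before `t` occurs in `f`, so a monomial that contains `t` exceeds every monomial of
  -- `f` that does not.
  rw [MonomialOrder.lex_lt_iff, Finsupp.Lex.lt_iff]
  refine ⟨t, fun s hs => ?_, ?_⟩
  · have h1 : ∀ ν, coeff ν f ≠ 0 → ν s = 0 := fun ν hν => by
      by_contra hne
      exact hν (degreeOf_eq_zero_iff_coeff.1 (h.2 s hs) ν hne)
    have h2 := h1 _ ((MonomialOrder.lex (σ := Fin n)).coeff_degree_ne_zero_iff.2 h.ne_zero)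
    exact h2.trans (h1 μ hμ).symm
  · change (MonomialOrder.lex (σ := Fin n)).degree f t < μ t
    omega

/-- If `f ^ r` lies over a subfield up to a scalar and up to a polynomial that does not involve
the first variable of `f`, then `f` lies over the subfield up to a scalar, provided `r ≥ 2`. -/
theorem IsFirstVar.exists_smul_mem_coeffSubring [CharZero K] {k : Subfield K} {n : ℕ}
    {f g : MvPolynomial (Fin n) K} {t : Fin n} (h : IsFirstVar f t) (hg : degreeOf t g = 0)
    {r : ℕ} (hr : 1 < r) {c : K} (hc : c ≠ 0) (hfg : c • f ^ r + g ∈ coeffSubring (Fin n) k) :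
    ∃ e : K, e ≠ 0 ∧ e • f ∈ coeffSubring (Fin n) k := by
  classical
  set o := MonomialOrder.lex (σ := Fin n) with ho
  have hlc : o.leadingCoeff f ≠ 0 := MonomialOrder.leadingCoeff_ne_zero_iff.2 h.ne_zero
  -- reduction to the monic case
  refine ⟨(o.leadingCoeff f)⁻¹, inv_ne_zero hlc, ?_⟩
  set z := (o.leadingCoeff f)⁻¹ • f with hz
  have hdeg : o.degree z = o.degree f := by
    rw [hz, MonomialOrder.degree_smul_of_isRegular]
    exact IsRegular.of_ne_zero (inv_ne_zero hlc)
  set α := o.degree f with hα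
  have hαt : α t ≠ 0 := h.degree_lex_ne_zero
  have hzα : coeff α z = 1 := by
    rw [hz, coeff_smul, smul_eq_mul]
    exact inv_mul_cancel₀ hlc
  have hmon : o.Monic z := by
    rw [MonomialOrder.Monic, MonomialOrder.leadingCoeff, hdeg, hzα]
  obtain ⟨c', hc', hcz⟩ : ∃ c' : K, c' ≠ 0 ∧ c • f ^ r = c' • z ^ r := by
    refine ⟨c * o.leadingCoeff f ^ r, mul_ne_zero hc (pow_ne_zero _ hlc), ?_⟩
    rw [hz, smul_pow, smul_smul, inv_pow, mul_assoc, mul_inv_cancel₀ (pow_ne_zero _ hlc), mul_one]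
  rw [hcz] at hfg
  -- Monomials that contain `t` do not see `g`.
  have key : ∀ μ : Fin n →₀ ℕ, μ t ≠ 0 → c' * coeff μ (z ^ r) ∈ k := fun μ hμ => by
    have := hfg μ
    rwa [coeff_add, degreeOf_eq_zero_iff_coeff.1 hg μ hμ, add_zero, coeff_smul,
      smul_eq_mul] at this
  -- As `z` is monic, `c'` is the coefficient of `c' • z ^ r` at its leading monomial `r • α`, which
  -- contains `t`.
  have hc'k : c' ∈ k := by
    have h1 := key (r • α) (by simp [hαt]; omega)
    have h2 := o.coeff_pow_nsmul_degree z r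
    rw [hdeg, hmon.leadingCoeff_eq_one, one_pow] at h2
    rwa [h2, mul_one] at h1
  have key' : ∀ μ : Fin n →₀ ℕ, μ t ≠ 0 → coeff μ (z ^ r) ∈ k := fun μ hμ => by
    have := div_mem (key μ hμ) hc'k
    rwa [mul_div_cancel_left₀ _ hc'] at this
  -- the part of `z` over the subfield
  set a : MvPolynomial (Fin n) K := ∑ μ ∈ z.support.filter (fun μ => coeff μ z ∈ k),
    monomial μ (coeff μ z) with ha
  have hac : ∀ μ, coeff μ a = if coeff μ z ∈ k then coeff μ z else 0 := fun μ => by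
    rw [ha, coeff_sum]
    simp only [coeff_monomial, Finset.sum_ite_eq', Finset.mem_filter, mem_support_iff]
    by_cases h0 : coeff μ z = 0 <;> simp [h0]
  have hak : a ∈ coeffSubring (Fin n) k := fun μ => by
    rw [hac]
    split_ifs with h1
    exacts [h1, zero_mem _]
  by_contra hzk
  have hb0 : z - a ≠ 0 := fun h0 => hzk (by rwa [sub_eq_zero.1 h0])
  -- The largest monomial of `z` whose coefficient is outside `k`; the contradiction will be that
  -- this coefficient lies in `k`.
  set μ := o.degree (z - a) with hμ
  have hμc : coeff μ (z - a) ≠ 0 := MonomialOrder.coeff_degree_ne_zero_iff.2 hb0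
  have hμk : coeff μ z ∉ k := fun h1 => by
    apply hμc
    rw [coeff_sub, hac, if_pos h1, sub_self]
  have hμz : coeff μ (z - a) = coeff μ z := by rw [coeff_sub, hac, if_neg hμk, sub_zero]
  have haα : coeff α a = 1 := by
    rw [hac, hzα, if_pos (one_mem _)]
  have hadeg : o.degree a = α := by
    apply o.toSyn.injective
    apply le_antisymm
    · rw [MonomialOrder.degree_le_iff]
      intro ν hν
      rw [← hdeg]
      apply o.le_degree
      rw [mem_support_iff] at hν ⊢
      intro h0
      rw [hac, h0] at hν
      simp at hν
    · apply o.le_degree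
      rw [mem_support_iff, haα]
      exact one_ne_zero
  have hamon : o.Monic a := by
    rw [MonomialOrder.Monic, MonomialOrder.leadingCoeff, hadeg, haα]
  -- the cofactor of `z - a` in `z ^ r - a ^ r`
  set Q : MvPolynomial (Fin n) K := ∑ i ∈ Finset.range r, z ^ i * a ^ (r - 1 - i) with hQ
  have hmonQ : ∀ i ∈ Finset.range r, o.degree (z ^ i * a ^ (r - 1 - i)) = (r - 1) • α ∧
      coeff ((r - 1) • α) (z ^ i * a ^ (r - 1 - i)) = 1 := fun i hi => by
    have hm : o.Monic (z ^ i * a ^ (r - 1 - i)) := hmon.pow.mul hamon.pow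
    have hd : o.degree (z ^ i * a ^ (r - 1 - i)) = (r - 1) • α := by
      rw [MonomialOrder.degree_mul hmon.pow.ne_zero hamon.pow.ne_zero, MonomialOrder.degree_pow,
        MonomialOrder.degree_pow, hdeg, hadeg, ← add_nsmul]
      congr 1
      have := Finset.mem_range.1 hi
      omega
    exact ⟨hd, hd ▸ hm.coeff_degree⟩
  -- The `r` summands of `Q` are monic of the same degree, so their leading terms add up to `r`,
  -- which is non-zero in characteristic zero.
  have hQc : coeff ((r - 1) • α) Q = r := by
    rw [hQ, coeff_sum, Finset.sum_congr rfl fun i hi => (hmonQ i hi).2]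
    simp
  have hQd : o.degree Q = (r - 1) • α := by
    apply o.toSyn.injective
    apply le_antisymm
    · refine MonomialOrder.degree_sum_le.trans (Finset.sup_le fun i hi => ?_)
      exact (congrArg o.toSyn (hmonQ i hi).1).le
    · apply o.le_degree
      rw [mem_support_iff, hQc]
      exact_mod_cast (by omega : r ≠ 0)
  have hfac : Q * (z - a) = z ^ r - a ^ r := by
    rw [hQ]
    exact Commute.geom_sum₂_mul (Commute.all _ _) _
  have hcoef : coeff ((r - 1) • α + μ) (z ^ r - a ^ r) = r * coeff μ z := by
    rw [← hfac, ← hμz, ← hQc, ← hQd, hμ, MonomialOrder.coeff_mul_of_degree_add]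
    rfl
  -- Since `r ≥ 2`, the factor `(r - 1) • α` makes this monomial contain `t`, whether or not `μ`
  -- does.
  have hmem : coeff ((r - 1) • α + μ) (z ^ r - a ^ r) ∈ k := by
    rw [coeff_sub]
    refine sub_mem (key' _ ?_) (pow_mem hak r _)
    simp only [Finsupp.add_apply, Finsupp.smul_apply, smul_eq_mul]
    have : 0 < (r - 1) * α t := Nat.mul_pos (by omega) (Nat.pos_of_ne_zero hαt)
    omega
  rw [hcoef] at hmem
  have h3 := div_mem hmem (natCast_mem k r)
  rw [mul_div_cancel_left₀ _ (by exact_mod_cast (by omega : r ≠ 0))] at h3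
  exact hμk h3

end FirstVar

/-! ### First variables of convolutions -/

/-- The entry of the input with which the `j`-th entry of the filter is multiplied in the `i`-th
entry of a convolution. -/
def convIndex {k s d d' : ℕ} (hd : d = s * (d' - 1) + k) (i : Fin d') (j : Fin k) : Fin d :=
  ⟨s * i + j, by
    have h1 : s * (i : ℕ) ≤ s * (d' - 1) := Nat.mul_le_mul_left s (by have := i.2; omega)
    have h2 := j.2
    omega⟩

theorem conv_eq_sum {R A : Type*} [CommSemiring R] [CommSemiring A] [Algebra R A] {k s d d' : ℕ}
    (hd : d = s * (d' - 1) + k) (w : Fin k → R) (x : Fin d → A) (i : Fin d') :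
    conv hd w x i = ∑ j, w j • x (convIndex hd i j) := rfl

theorem convIndex_strictMono_right {k s d d' : ℕ} (hd : d = s * (d' - 1) + k) (i : Fin d') :
    StrictMono (convIndex hd i) := fun j j' h => by
  rw [Fin.lt_def] at h ⊢
  simp only [convIndex]
  omega

theorem convIndex_strictMono_left {k s d d' : ℕ} (hd : d = s * (d' - 1) + k) (hs : 0 < s)
    (j : Fin k) : StrictMono fun i => convIndex hd i j := fun i i' h => by
  have := Nat.mul_lt_mul_of_pos_left (Fin.lt_def.1 h) hs
  rw [Fin.lt_def]
  simp only [convIndex]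
  omega

/-- The first variables of the entries of the vector form a strictly increasing sequence. -/
def HasFirstVars {K : Type*} [Field K] {n d : ℕ} (y : Fin d → MvPolynomial (Fin n) K) : Prop :=
  ∃ t : Fin d → Fin n, StrictMono t ∧ ∀ i, IsFirstVar (y i) (t i)

section Conv

variable {K : Type*} [Field K] {n : ℕ}

theorem hasFirstVars_X : HasFirstVars (X : Fin n → MvPolynomial (Fin n) K) :=
  ⟨id, strictMono_id, isFirstVar_X⟩

theorem HasFirstVars.pow {d r : ℕ} {y : Fin d → MvPolynomial (Fin n) K} (h : HasFirstVars y)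
    (hr : 0 < r) : HasFirstVars fun i => y i ^ r := by
  obtain ⟨t, ht, hy⟩ := h
  exact ⟨t, ht, fun i => (hy i).pow hr⟩

/-- Take `j` to be the first non-zero position of the filter: later positions meet entries of `y`
whose first variables come later. The position depends only on `w`, so the same `j` serves all
outputs. -/
theorem conv_eq_smul_add {k s d d' : ℕ} (hd : d = s * (d' - 1) + k) {w : Fin k → K} (hw : w ≠ 0)
    {y : Fin d → MvPolynomial (Fin n) K} {t : Fin d → Fin n} (ht : StrictMono t)
    (hy : ∀ i, IsFirstVar (y i) (t i)) :
    ∃ j : Fin k, w j ≠ 0 ∧ ∀ i, ∃ g, conv hd w y i = w j • y (convIndex hd i j) + g ∧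
      ∀ v ≤ t (convIndex hd i j), degreeOf v g = 0 := by
  classical
  obtain ⟨j₀, hj₀⟩ := Function.ne_iff.1 hw
  obtain ⟨j, hj, hmin⟩ := (Finset.univ.filter fun j => w j ≠ 0).exists_min_image id
    ⟨j₀, by simpa using hj₀⟩
  simp only [Finset.mem_filter, Finset.mem_univ, true_and, id] at hj hmin
  refine ⟨j, hj, fun i => ⟨∑ l ∈ Finset.univ.erase j, w l • y (convIndex hd i l), ?_, ?_⟩⟩
  · exact (Finset.add_sum_erase _ (fun l => w l • y (convIndex hd i l)) (Finset.mem_univ j)).symm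
  · intro v hv
    refine degreeOf_sum_eq_zero fun l hl => ?_
    by_cases hl0 : w l = 0
    · simp [hl0]
    · have hjl : j < l := lt_of_le_of_ne (hmin l hl0) (Finset.ne_of_mem_erase hl).symm
      exact degreeOf_smul_eq_zero _
        ((hy _).2 v (hv.trans_lt (ht (convIndex_strictMono_right hd i hjl))))

theorem HasFirstVars.conv {k s d d' : ℕ} (hd : d = s * (d' - 1) + k) (hs : 0 < s)
    {w : Fin k → K} (hw : w ≠ 0) {y : Fin d → MvPolynomial (Fin n) K} (h : HasFirstVars y) :
    HasFirstVars (conv hd w y) := by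
  obtain ⟨t, ht, hy⟩ := h
  obtain ⟨j, hj, hg⟩ := conv_eq_smul_add hd hw ht hy
  refine ⟨fun i => t (convIndex hd i j), ht.comp (convIndex_strictMono_left hd hs j),
    fun i => ?_⟩
  obtain ⟨g, hgi, hgv⟩ := hg i
  rw [hgi]
  refine ⟨fun h0 => ?_, fun v hv => ?_⟩
  · obtain ⟨μ, hμ, hμc⟩ := (hy (convIndex hd i j)).exists_coeff_ne_zero
    have := degreeOf_eq_zero_iff_coeff.1 h0 μ hμ
    rw [coeff_add, degreeOf_eq_zero_iff_coeff.1 (hgv _ le_rfl) μ hμ, add_zero, coeff_smul,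
      smul_eq_mul] at this
    exact mul_ne_zero hj hμc this
  · have h1 := degreeOf_smul_eq_zero (w j) ((hy (convIndex hd i j)).2 v hv)
    have h2 := degreeOf_add_le v (w j • y (convIndex hd i j)) g
    rw [h1, hgv v hv.le] at h2
    simpa using h2

/-- Distinct first variables put the entries of `y` in triangular position, so the coefficients of
the combination can be solved for inside `k`. -/
theorem HasFirstVars.filter_mem {k : Subfield K} {q s d d' : ℕ} (hd : d = s * (d' - 1) + q)
    {w : Fin q → K} {y : Fin d → MvPolynomial (Fin n) K} (h : HasFirstVars y)
    (hy : ∀ i, y i ∈ coeffSubring (Fin n) k) {i : Fin d'} {c : K}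
    (hc : c • _root_.conv hd w y i ∈ coeffSubring (Fin n) k) (j : Fin q) : c * w j ∈ k := by
  obtain ⟨t, ht, hyt⟩ := h
  choose μ hμt hμ using fun i => (hyt i).exists_coeff_ne_zero
  refine coeff_mem_of_sum_mem (fun j => hy (convIndex hd i j)) (fun j => μ (convIndex hd i j))
    (fun j => hμ _) (fun j j' hjj => ?_) (fun j => c * w j) ?_ j
  · refine degreeOf_eq_zero_iff_coeff.1 ((hyt _).2 (t (convIndex hd i j)) ?_) _ (hμt _)
    exact ht (convIndex_strictMono_right hd i hjj)
  · rw [conv_eq_sum, Finset.smul_sum] at hc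
    simpa only [mul_smul] using hc

end Conv

/-! ### Descent of the filters to a subfield -/

namespace PolyCNN

variable (N : PolyCNN)

theorem feature_hasFirstVars {K : Type*} [Field K] (w : N.Weights K) (hw : ∀ i, w i ≠ 0) :
    ∀ (n : ℕ) (h : n ≤ N.L),
      HasFirstVars (N.feature w (X : Fin (N.d 0) → MvPolynomial (Fin (N.d 0)) K) n h)
  | 0, _ => hasFirstVars_X
  | 1, h => by
      rw [feature]
      exact hasFirstVars_X.conv _ (N.s_pos _) (hw _)
  | n + 2, h => by
      rw [feature]
      exact ((feature_hasFirstVars w hw (n + 1) (Nat.le_of_succ_le h)).pow N.r_pos).conv _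
        (N.s_pos _) (hw _)

theorem net_ne_zero {K : Type*} [Field K] (w : N.Weights K) (hw : ∀ i, w i ≠ 0)
    (i : Fin (N.d (Fin.last N.L))) :
    N.net w (X : Fin (N.d 0) → MvPolynomial (Fin (N.d 0)) K) i ≠ 0 := by
  obtain ⟨t, -, ht⟩ := N.feature_hasFirstVars w hw N.L le_rfl
  exact (ht i).ne_zero

theorem feature_mem_coeffSubring {K : Type*} [Field K] {k : Subfield K} (w : N.Weights K) :
    ∀ (n : ℕ) (h : n ≤ N.L), (∀ l : Fin N.L, (l : ℕ) < n → ∀ j, w l j ∈ k) → ∀ i,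
      N.feature w (X : Fin (N.d 0) → MvPolynomial (Fin (N.d 0)) K) n h i ∈
        coeffSubring (Fin (N.d 0)) k
  | 0, _, _, i => X_mem_coeffSubring i
  | 1, h, hw, i => by
      rw [feature]
      exact sum_mem fun j _ => smul_mem_coeffSubring (hw _ zero_lt_one j) (X_mem_coeffSubring _)
  | n + 2, h, hw, i => by
      rw [feature]
      exact sum_mem fun j _ => smul_mem_coeffSubring (hw _ (Nat.lt_succ_self _) j)
        (pow_mem (feature_mem_coeffSubring w (n + 1) (Nat.le_of_succ_le h)
          (fun l hl => hw l (by omega)) _) _)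

/-- The activation is homogeneous, so scalars on filters move to the output. This allows each filter
to be normalized separately, to be integral or to lie over a subfield. -/
theorem feature_smul_weights {K A : Type*} [Field K] [CommSemiring A] [Algebra K A]
    (w : N.Weights K) (c : Fin N.L → K) (hc : ∀ i, c i ≠ 0) (x : Fin (N.d 0) → A) :
    ∀ (n : ℕ) (h : n ≤ N.L), ∃ b : K, b ≠ 0 ∧
      N.feature (fun i => c i • w i) x n h = b • N.feature w x n h
  | 0, _ => ⟨1, one_ne_zero, (one_smul K x).symm⟩
  | 1, h => ⟨c ⟨0, h⟩, hc _, by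
      ext i
      simp [feature, conv, Finset.smul_sum, mul_smul]⟩
  | n + 2, h => by
      obtain ⟨b, hb, hbw⟩ := feature_smul_weights w c hc x (n + 1) (Nat.le_of_succ_le h)
      refine ⟨c ⟨n + 1, h⟩ * b ^ N.r, mul_ne_zero (hc _) (pow_ne_zero _ hb), ?_⟩
      ext i
      simp only [feature, conv, hbw, Pi.smul_apply, smul_pow, Finset.smul_sum, smul_smul,
        smul_eq_mul]
      exact Finset.sum_congr rfl fun j _ => by congr 1; ring

/-- If a feature of a network with activation degree at least two lies over a subfield up to a
scalar, then so do the filters that produce it. -/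
theorem exists_smul_weights_mem {K : Type*} [Field K] [CharZero K] {k : Subfield K}
    (hr : 1 < N.r) (w : N.Weights K) (hw : ∀ i, w i ≠ 0) :
    ∀ (n : ℕ) (h : n ≤ N.L) (i : Fin _) (c : K), c ≠ 0 →
      c • N.feature w (X : Fin (N.d 0) → MvPolynomial (Fin (N.d 0)) K) n h i ∈
        coeffSubring (Fin (N.d 0)) k →
      ∀ l : Fin N.L, (l : ℕ) < n → ∃ e : K, e ≠ 0 ∧ ∀ j, e * w l j ∈ k
  | 0, _, _, _, _, _, l, hl => absurd hl (Nat.not_lt_zero _)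
  | 1, h, i, c, hc, hmem, l, hl => by
      obtain rfl : l = ⟨0, h⟩ := Fin.ext (by simpa using hl)
      rw [feature] at hmem
      exact ⟨c, hc, hasFirstVars_X.filter_mem _ X_mem_coeffSubring hmem⟩
  | n + 2, h, i, c, hc, hmem, l, hl => by
      have h' := Nat.le_of_succ_le h
      rw [feature] at hmem
      have hfv := N.feature_hasFirstVars w hw (n + 1) h'
      -- One output entry suffices: it exposes the `r`-th power of a single entry of the previous
      -- feature, to which the descent for powers and then the induction apply.
      have ih : ∀ l : Fin N.L, (l : ℕ) < n + 1 → ∃ e : K, e ≠ 0 ∧ ∀ j, e * w l j ∈ k := by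
        obtain ⟨t, ht, hft⟩ := hfv
        obtain ⟨j, hj, hg⟩ := conv_eq_smul_add (N.d_eq ⟨n + 1, h⟩) (hw ⟨n + 1, h⟩) ht
          (fun i => (hft i).pow N.r_pos)
        obtain ⟨g, hgi, hgv⟩ := hg i
        rw [hgi, smul_add, smul_smul] at hmem
        obtain ⟨e, he, hmem'⟩ := (hft _).exists_smul_mem_coeffSubring
          (degreeOf_smul_eq_zero c (hgv _ le_rfl)) hr (mul_ne_zero hc hj) hmem
        exact exists_smul_weights_mem hr w hw (n + 1) h' _ e he hmem'
      by_cases hln : (l : ℕ) < n + 1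
      · exact ih l hln
      obtain rfl : l = ⟨n + 1, h⟩ := Fin.ext (by change (l : ℕ) = n + 1; omega)
      have : ∀ l : Fin N.L, ∃ e : K, e ≠ 0 ∧ ((l : ℕ) < n + 1 → ∀ j, e * w l j ∈ k) := fun l => by
        by_cases hl' : (l : ℕ) < n + 1
        · obtain ⟨e, he, hek⟩ := ih l hl'
          exact ⟨e, he, fun _ => hek⟩
        · exact ⟨1, one_ne_zero, fun h0 => absurd h0 hl'⟩
      choose e he hek using this
      obtain ⟨b, hb, hbw⟩ := N.feature_smul_weights w e he
        (X : Fin (N.d 0) → MvPolynomial (Fin (N.d 0)) K) (n + 1) h'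
      have hbk : ∀ i, b • N.feature w (X : Fin (N.d 0) → MvPolynomial (Fin (N.d 0)) K) (n + 1) h' i
          ∈ coeffSubring (Fin (N.d 0)) k := fun i => by
        have := N.feature_mem_coeffSubring (k := k) (fun l => e l • w l) (n + 1) h' hek i
        rwa [hbw] at this
      have hbfv : HasFirstVars fun i =>
          (N.feature (fun l => e l • w l) (X : Fin (N.d 0) → MvPolynomial (Fin (N.d 0)) K)
            (n + 1) h' i) ^ N.r :=
        (N.feature_hasFirstVars _ (fun l => smul_ne_zero (he l) (hw l)) (n + 1) h').pow N.r_pos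
      rw [hbw] at hbfv
      have hbr : b ^ N.r ≠ 0 := pow_ne_zero _ hb
      -- Rescaling the earlier filters multiplies the input of the last convolution by `b ^ r`; the
      -- scalar for the last filter undoes this.
      refine ⟨c * (b ^ N.r)⁻¹, mul_ne_zero hc (inv_ne_zero hbr), ?_⟩
      refine hbfv.filter_mem (N.d_eq ⟨n + 1, h⟩) (fun i => pow_mem (hbk i) _) (i := i) ?_
      convert hmem using 1
      simp only [conv_eq_sum, Finset.smul_sum, Pi.smul_apply, smul_pow, smul_smul]
      refine Finset.sum_congr rfl fun j _ => ?_
      congr 1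
      field_simp

end PolyCNN

/-! ### Specialization of the generic network -/

/-- Over a valuation ring, a non-zero vector may be scaled to an integral vector with an entry
equal to one. -/
theorem ValuationSubring.exists_mul_mem {K : Type*} [Field K] (B : ValuationSubring K) {k : ℕ}
    {v : Fin k → K} (hv : v ≠ 0) :
    ∃ a : K, a ≠ 0 ∧ (∀ j, a * v j ∈ B) ∧ ∃ j, a * v j = 1 := by
  obtain ⟨j₀, hj₀⟩ := Function.ne_iff.1 hv
  -- Division by an entry of largest valuation brings all entries into `B`.
  obtain ⟨j, -, hmax⟩ := Finset.univ.exists_max_image (fun j => B.valuation (v j))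
    ⟨j₀, Finset.mem_univ _⟩
  have hj : v j ≠ 0 := fun h0 => by
    have := hmax j₀ (Finset.mem_univ _)
    rw [h0, map_zero, le_zero_iff, map_eq_zero] at this
    exact hj₀ this
  refine ⟨(v j)⁻¹, inv_ne_zero hj, fun i => ?_, j, inv_mul_cancel₀ hj⟩
  rw [← B.valuation_le_one_iff, map_mul, map_inv₀, inv_mul_eq_div]
  exact div_le_one_of_le₀ (hmax i (Finset.mem_univ _)) zero_le

namespace PolyCNN

variable (N : PolyCNN)

/-- Networks commute with a change of the coefficient ring, in particular with evaluation of the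
indeterminate weights and with reduction to a residue field. -/
theorem map_feature_semilinear {R R' A B : Type*} [CommSemiring R] [CommSemiring R']
    [CommSemiring A] [Algebra R A] [CommSemiring B] [Algebra R' B] (g : R →+* R') (f : A →+* B)
    (hfg : ∀ r a, f (r • a) = g r • f a) (w : N.Weights R) (x : Fin (N.d 0) → A) :
    ∀ (n : ℕ) (h : n ≤ N.L) (i : Fin _),
      f (N.feature w x n h i) = N.feature (fun l j => g (w l j)) (fun j => f (x j)) n h i
  | 0, _, _ => rfl
  | 1, _, _ => by simp [feature, conv, hfg]
  | n + 2, h, i => by simp [feature, conv, hfg, map_feature_semilinear g f hfg w x (n + 1)]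

theorem map_net_X {R R' : Type*} [CommSemiring R] [CommSemiring R'] (g : R →+* R')
    (w : N.Weights R) (i : Fin (N.d (Fin.last N.L))) :
    MvPolynomial.map g (N.net w (X : Fin (N.d 0) → MvPolynomial (Fin (N.d 0)) R) i) =
      N.net (fun l j => g (w l j)) (X : Fin (N.d 0) → MvPolynomial (Fin (N.d 0)) R') i := by
  have := N.map_feature_semilinear g (MvPolynomial.map (σ := Fin (N.d 0)) g)
    (fun r a => by simp [smul_eq_C_mul]) w X N.L le_rfl i
  simpa [net] using this

/-- The coordinates of the ambient space: the coefficients of the polynomials. -/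
abbrev CoordIndex : Type := Fin (N.d (Fin.last N.L)) × (Fin (N.d 0) →₀ ℕ)

/-- A coordinate of a tuple of polynomials. -/
def coord (x : N.CoordIndex) : Module.Dual ℝ N.Ambient :=
  (lcoeff ℝ x.2).comp ((homogeneousSubmodule _ ℝ _).subtype.comp (LinearMap.proj x.1))

theorem coord_apply (x : N.CoordIndex) (v : N.Ambient) :
    N.coord x v = coeff x.2 (v x.1 : MvPolynomial (Fin (N.d 0)) ℝ) := rfl

/-- The coordinates of the network with indeterminate weights. -/
def genericCoord (x : N.CoordIndex) : MvPolynomial (Σ i : Fin N.L, Fin (N.k i)) ℝ :=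
  coeff x.2 (N.net (fun l j => X ⟨l, j⟩ : N.Weights (MvPolynomial (Σ i : Fin N.L, Fin (N.k i)) ℝ))
    (X : Fin (N.d 0) → MvPolynomial (Fin (N.d 0)) (MvPolynomial (Σ i : Fin N.L, Fin (N.k i)) ℝ))
    x.1)

theorem eval_genericCoord (w : N.Weights ℝ) (x : N.CoordIndex) :
    eval (fun a : Σ i : Fin N.L, Fin (N.k i) => w a.1 a.2) (N.genericCoord x) =
      N.coord x (N.param w) := by
  rw [genericCoord, ← coeff_map, map_net_X, coord_apply]
  simp [param]

theorem eval_aeval_genericCoord (w : N.Weights ℝ) (f : MvPolynomial N.CoordIndex ℝ) :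
    eval (fun a : Σ i : Fin N.L, Fin (N.k i) => w a.1 a.2) (aeval N.genericCoord f) =
      eval (fun x => N.coord x (N.param w)) f := by
  simp only [← N.eval_genericCoord]
  rw [← coe_aeval_eq_eval, ← coe_aeval_eq_eval, RingHom.coe_coe, RingHom.coe_coe,
    ← AlgHom.comp_apply, comp_aeval]

/-- A point at which all polynomials vanish that vanish on the neuromanifold is, over some
extension field, a scalar multiple of a network without vanishing filters. -/
theorem exists_extension (p : N.Ambient)
    (hp : ∀ f : MvPolynomial N.CoordIndex ℝ,
      (∀ w, eval (fun x => N.coord x (N.param w)) f = 0) → eval (fun x => N.coord x p) f = 0) :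
    ∃ (κ : Type) (_ : Field κ) (_ : Algebra ℝ κ) (w : N.Weights κ) (c : κ), (∀ i, w i ≠ 0) ∧
      ∀ i, MvPolynomial.map (algebraMap ℝ κ) (p i : MvPolynomial (Fin (N.d 0)) ℝ) =
        c • N.net w (X : Fin (N.d 0) → MvPolynomial (Fin (N.d 0)) κ) i := by
  let S := MvPolynomial (Σ i : Fin N.L, Fin (N.k i)) ℝ
  let K := FractionRing S
  have hinj : Function.Injective (algebraMap S K) := IsFractionRing.injective S K
  let Ψ : MvPolynomial N.CoordIndex ℝ →+* K :=
    (algebraMap S K).comp (aeval N.genericCoord : MvPolynomial N.CoordIndex ℝ →ₐ[ℝ] S).toRingHom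
  let ev : MvPolynomial N.CoordIndex ℝ →+* ℝ := eval fun x => N.coord x p
  -- Relations among the coordinates of the generic network vanish on the neuromanifold, hence at
  -- `p`. So evaluation at `p` descends to the subring `Ψ.range` of `K`.
  have hker : ∀ f, Ψ f = 0 → ev f = 0 := fun f hf => hp f fun w => by
    rw [← N.eval_aeval_genericCoord]
    have h0 : (aeval N.genericCoord f : S) = 0 := hinj (by rw [map_zero]; exact hf)
    rw [h0, map_zero]
  have hsurj : Function.Surjective Ψ.rangeRestrict := Ψ.rangeRestrict_surjective
  let I : Ideal Ψ.range := (RingHom.ker ev).map Ψ.rangeRestrict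
  have hI : I ≠ ⊤ := by
    rw [Ne, Ideal.eq_top_iff_one, Ideal.mem_map_iff_of_surjective _ hsurj]
    rintro ⟨f, hf, hf1⟩
    have h1 : Ψ f = 1 := congrArg Subtype.val hf1
    have h2 := hker (1 - f) (by rw [map_sub, h1, map_one, sub_self])
    rw [map_sub, (RingHom.mem_ker).1 hf, map_one, sub_zero] at h2
    exact one_ne_zero h2
  -- A valuation ring of `K` that contains the generic coordinates and in which everything vanishing
  -- at `p` is a non-unit.
  obtain ⟨B, hB, hIB⟩ := Ideal.image_subset_nonunits_valuationSubring I hI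
  have hΨB : ∀ f, Ψ f ∈ B := fun f => hB ⟨f, rfl⟩
  let ρ : ℝ →+* B := (Ψ.comp C).codRestrict B.toSubring fun r => hΨB (C r)
  let res : B →+* IsLocalRing.ResidueField B := IsLocalRing.residue B
  -- Modulo the maximal ideal of `B`, the generic coordinates become those of `p`.
  have hres : ∀ f, res ⟨Ψ f, hΨB f⟩ = res (ρ (ev f)) := fun f => by
    rw [← sub_eq_zero, ← map_sub]
    refine (IsLocalRing.residue_eq_zero_iff _).2 ?_
    have hmem : Ψ.rangeRestrict (f - C (ev f)) ∈ I := Ideal.mem_map_of_mem _ (by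
      rw [RingHom.mem_ker, map_sub, sub_eq_zero]
      simp [ev])
    obtain ⟨ha, ham⟩ := ValuationSubring.mem_nonunits_iff_exists_mem_maximalIdeal.1
      (hIB ⟨_, hmem, rfl⟩)
    convert ham using 1
    apply Subtype.ext
    change Ψ f - Ψ (C (ev f)) = Ψ (f - C (ev f))
    rw [map_sub]
  let W : N.Weights S := fun l j => X ⟨l, j⟩
  let WK : N.Weights K := fun l j => algebraMap S K (W l j)
  have hWK : ∀ l, WK l ≠ 0 := fun l h0 => by
    have h1 : algebraMap S K (W l ⟨0, N.k_pos l⟩) = 0 := congrFun h0 ⟨0, N.k_pos l⟩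
    exact X_ne_zero _ (hinj (h1.trans (map_zero _).symm))
  -- Each generic filter is scaled to be integral with an entry 1, so that its reduction is
  -- non-zero.
  choose a ha haB j₁ hj₁ using fun l => B.exists_mul_mem (hWK l)
  let WB : N.Weights B := fun l j => ⟨a l * WK l j, haB l j⟩
  let w : N.Weights (IsLocalRing.ResidueField B) := fun l j => res (WB l j)
  have hw : ∀ l, w l ≠ 0 := fun l h0 => by
    have h1 : res (WB l (j₁ l)) = 0 := congrFun h0 (j₁ l)
    have h2 : WB l (j₁ l) = 1 := Subtype.ext (hj₁ l)
    rw [h2, map_one] at h1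
    exact one_ne_zero h1
  obtain ⟨b, hb, hbW⟩ := N.feature_smul_weights WK a ha
    (X : Fin (N.d 0) → MvPolynomial (Fin (N.d 0)) K) N.L le_rfl
  have hcoef : ∀ x : N.CoordIndex,
      ((coeff x.2 (N.net WB (X : Fin (N.d 0) → MvPolynomial (Fin (N.d 0)) B) x.1) : B) : K) =
        b * Ψ (X x) := fun x => by
    have h1 : Ψ (X x) = coeff x.2 (N.net WK (X : Fin (N.d 0) → MvPolynomial (Fin (N.d 0)) K) x.1) := by
      change algebraMap S K (aeval N.genericCoord (X x)) = _
      rw [aeval_X, genericCoord, ← coeff_map, map_net_X]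
    have h2 := congrArg (coeff x.2) (N.map_net_X B.subtype WB x.1)
    rw [coeff_map] at h2
    refine h2.trans ?_
    have h3 := congrArg (coeff x.2) (congrFun hbW x.1)
    rw [Pi.smul_apply, coeff_smul, smul_eq_mul] at h3
    rw [h1]
    exact h3
  have hcoefw : ∀ x : N.CoordIndex,
      res (coeff x.2 (N.net WB (X : Fin (N.d 0) → MvPolynomial (Fin (N.d 0)) B) x.1)) =
        coeff x.2 (N.net w (X : Fin (N.d 0) →
          MvPolynomial (Fin (N.d 0)) (IsLocalRing.ResidueField B)) x.1) := fun x => by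
    rw [← coeff_map, map_net_X]
  -- The reduced network is non-zero, so some coefficient of the integral network is a unit of `B`.
  -- It equals `b` times an element of `B`, which forces `b⁻¹` into `B`.
  obtain ⟨m, hm⟩ := MvPolynomial.ne_zero_iff.1 (N.net_ne_zero w hw ⟨0, N.d_last_pos⟩)
  rw [← hcoefw (⟨0, N.d_last_pos⟩, m)] at hm
  obtain ⟨u, hu⟩ := (IsLocalRing.residue_ne_zero_iff_isUnit _).1 hm
  have hbB : b⁻¹ ∈ B := by
    have h1 := hcoef (⟨0, N.d_last_pos⟩, m)
    rw [← hu] at h1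
    have h2 : ((↑u⁻¹ : B) : K) * ((u : B) : K) = 1 :=
      congrArg Subtype.val u.inv_mul
    have h3 : b⁻¹ = ((↑u⁻¹ : B) : K) * Ψ (X (⟨0, N.d_last_pos⟩, m)) := by
      rw [h1] at h2
      exact inv_eq_of_mul_eq_one_right (by linear_combination h2)
    rw [h3]
    exact mul_mem (Subtype.property _) (hΨB _)
  -- The scalar is the residue of `b⁻¹`; it is zero if `b⁻¹` is not a unit of `B`, and then `p = 0`.
  refine ⟨IsLocalRing.ResidueField B, inferInstance, (res.comp ρ).toAlgebra, w, res ⟨b⁻¹, hbB⟩,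
    hw, fun i => ?_⟩
  ext m
  rw [coeff_map, coeff_smul, ← hcoefw (i, m), smul_eq_mul, ← map_mul]
  have h1 := hres (X (i, m))
  have h2 : ev (X (i, m)) = coeff m (p i : MvPolynomial (Fin (N.d 0)) ℝ) := by
    simp [ev, coord_apply]
  rw [h2] at h1
  refine Eq.trans h1.symm (congrArg res (Subtype.ext ?_))
  change Ψ (X (i, m)) = b⁻¹ *
    ((coeff m (N.net WB (X : Fin (N.d 0) → MvPolynomial (Fin (N.d 0)) B) i) : B) : K)
  rw [hcoef (i, m), inv_mul_cancel_left₀ hb]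

end PolyCNN

/-! ### Closed sets of the Zariski topologies -/

section ZariskiClosed

variable {K V : Type*} [Field K] [AddCommGroup V] [Module K V]

theorem isClosed_affineZariski_iff {S : Set V} :
    IsClosed[affineZariskiTopology K V] S ↔
      ∃ P : Set (MvPolynomial (Module.Dual K V) K), S = {v | ∀ p ∈ P, polyValue p v = 0} := by
  rw [← @isOpen_compl_iff _ _ (affineZariskiTopology K V)]
  change Sᶜᶜ ∈ {S : Set V | ∃ P : Set (MvPolynomial (Module.Dual K V) K),
    S = {v | ∀ p ∈ P, polyValue p v = 0}} ↔ _
  rw [compl_compl]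
  rfl

theorem isClosed_projectiveZariski_iff {S : Set (ℙ K V)} :
    IsClosed[projectiveZariskiTopology K V] S ↔
      ∃ P : Set (MvPolynomial (Module.Dual K V) K), (∀ p ∈ P, ∃ n : ℕ, p.IsHomogeneous n) ∧
        S = {x | ∀ v : V, ∀ hv : v ≠ 0, x = Projectivization.mk K v hv →
          ∀ p ∈ P, polyValue p v = 0} := by
  rw [← @isOpen_compl_iff _ _ (projectiveZariskiTopology K V)]
  change Sᶜᶜ ∈ {S : Set (ℙ K V) | ∃ P : Set (MvPolynomial (Module.Dual K V) K),
    (∀ p ∈ P, ∃ n : ℕ, p.IsHomogeneous n) ∧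
      S = {x | ∀ v : V, ∀ hv : v ≠ 0, x = Projectivization.mk K v hv →
        ∀ p ∈ P, polyValue p v = 0}} ↔ _
  rw [compl_compl]
  rfl

theorem polyValue_smul {p : MvPolynomial (Module.Dual K V) K} {n : ℕ} (hp : p.IsHomogeneous n)
    (c : K) (v : V) : polyValue p (c • v) = c ^ n * polyValue p v := by
  rw [polyValue, polyValue, eval_eq, eval_eq, Finset.mul_sum]
  refine Finset.sum_congr rfl fun e he => ?_
  have hdeg : ∑ i ∈ e.support, e i = n := by
    rw [← hp (mem_support_iff.1 he)]
    exact DFunLike.congr_fun Finsupp.degree_eq_weight_one e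
  simp only [map_smul, smul_eq_mul, mul_pow, Finset.prod_mul_distrib, Finset.prod_pow_eq_pow_sum,
    hdeg]
  ring

theorem polyValue_eq_sum_homogeneousComponent (p : MvPolynomial (Module.Dual K V) K) (v : V) :
    polyValue p v =
      ∑ n ∈ Finset.range (p.totalDegree + 1), polyValue (homogeneousComponent n p) v := by
  conv_lhs => rw [← sum_homogeneousComponent p]
  simp only [polyValue, map_sum]

/-- A polynomial that vanishes on a line vanishes there component by component. -/
theorem polyValue_homogeneousComponent_eq_zero [Infinite K]
    {p : MvPolynomial (Module.Dual K V) K} {v : V} (h : ∀ c : K, polyValue p (c • v) = 0) (n : ℕ) :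
    polyValue (homogeneousComponent n p) v = 0 := by
  -- The restriction of `p` to the line through `v`, as a polynomial in the scalar; its coefficients
  -- are the values of the components.
  set H : Polynomial K := ∑ i ∈ Finset.range (p.totalDegree + 1),
    Polynomial.C (polyValue (homogeneousComponent i p) v) * Polynomial.X ^ i with hH
  have hH0 : H = 0 := Polynomial.funext fun c => by
    rw [Polynomial.eval_zero, ← h c, polyValue_eq_sum_homogeneousComponent, hH,
      Polynomial.eval_finsetSum]
    refine Finset.sum_congr rfl fun i _ => ?_
    rw [polyValue_smul (homogeneousComponent_isHomogeneous i p)]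
    rw [Polynomial.eval_mul, Polynomial.eval_C, Polynomial.eval_pow, Polynomial.eval_X, mul_comm]
  by_cases hn : n < p.totalDegree + 1
  · have := congrArg (fun q => Polynomial.coeff q n) hH0
    simp only [hH, Polynomial.finsetSum_coeff, Polynomial.coeff_C_mul, Polynomial.coeff_X_pow,
      mul_ite, mul_one, mul_zero, Finset.sum_ite_eq, Finset.mem_range, hn, if_true,
      Polynomial.coeff_zero] at this
    exact this
  · rw [homogeneousComponent_eq_zero _ _ (by omega)]
    simp [polyValue]

/-- A polynomial that vanishes at infinitely many points of an affine line vanishes on it. -/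
theorem polyValue_eq_zero_of_infinite {p : MvPolynomial (Module.Dual K V) K} (v u : V)
    (h : {t : K | polyValue p (v + t • u) = 0}.Infinite) (t : K) :
    polyValue p (v + t • u) = 0 := by
  set H : Polynomial K := aeval (fun l : Module.Dual K V =>
    Polynomial.C (l v) + Polynomial.X * Polynomial.C (l u)) p with hH
  have hev : ∀ t, Polynomial.eval t H = polyValue p (v + t • u) := fun t => by
    have : Polynomial.eval t H = (Polynomial.aeval t : Polynomial K →ₐ[K] K) H := by
      rw [Polynomial.coe_aeval_eq_eval]
    rw [this, hH, ← AlgHom.comp_apply, comp_aeval, polyValue, ← coe_aeval_eq_eval,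
      RingHom.coe_coe]
    congr 2
    ext l
    simp only [map_add, map_mul, map_smul, smul_eq_mul, Polynomial.coe_aeval_eq_eval,
      Polynomial.eval_C, Polynomial.eval_X]
  rw [← hev, Polynomial.eq_zero_of_infinite_isRoot H, Polynomial.eval_zero]
  simpa only [Polynomial.IsRoot, hev] using h

end ZariskiClosed

namespace PolyCNN

variable (N : PolyCNN)

/-! ### The neuromanifold is a cone -/

theorem feature_congr {R A : Type*} [CommSemiring R] [CommSemiring A] [Algebra R A]
    (w v : N.Weights R) (x : Fin (N.d 0) → A) : ∀ (n : ℕ) (h : n ≤ N.L),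
      (∀ l : Fin N.L, (l : ℕ) < n → w l = v l) → N.feature w x n h = N.feature v x n h
  | 0, _, _ => rfl
  | 1, _, hwv => by rw [feature, feature, hwv _ zero_lt_one]
  | n + 2, h, hwv => by
      rw [feature, feature, hwv _ (Nat.lt_succ_self _),
        feature_congr w v x (n + 1) (Nat.le_of_succ_le h) fun l hl => hwv l (by omega)]

theorem feature_eq_zero {R A : Type*} [CommSemiring R] [CommSemiring A] [Algebra R A]
    (w : N.Weights R) (x : Fin (N.d 0) → A) (l : Fin N.L) (hl : w l = 0) :
    ∀ (n : ℕ) (h : n ≤ N.L), (l : ℕ) < n → N.feature w x n h = 0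
  | 0, _, hn => absurd hn (Nat.not_lt_zero _)
  | 1, h, hn => by
      obtain rfl : l = ⟨0, h⟩ := Fin.ext (by simpa using hn)
      ext i
      simp [feature, conv, hl]
  | n + 2, h, hn => by
      ext i
      by_cases hln : (l : ℕ) < n + 1
      · simp [feature, conv, feature_eq_zero w x l hl (n + 1) (Nat.le_of_succ_le h) hln,
          N.r_pos.ne']
      · obtain rfl : l = ⟨n + 1, h⟩ := Fin.ext (by change (l : ℕ) = n + 1; omega)
        simp [feature, conv, hl]

/-- No activation follows the last convolution, so the scalar goes into that filter alone. No `r`-th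
root is needed, and `t` may be zero or negative. -/
theorem feature_smul_last {R A : Type*} [CommSemiring R] [CommSemiring A] [Algebra R A]
    (w : N.Weights R) (x : Fin (N.d 0) → A) (t : R) : ∀ (n : ℕ) (h : n ≤ N.L), 0 < n →
      N.feature (fun l => (if (l : ℕ) + 1 = n then t else 1) • w l) x n h = t • N.feature w x n h
  | 0, _, hn => absurd hn (lt_irrefl _)
  | 1, h, _ => by
      ext i
      simp [feature, conv, Finset.smul_sum, mul_smul]
  | n + 2, h, _ => by
      have h1 := N.feature_congr (fun l => (if (l : ℕ) + 1 = n + 2 then t else 1) • w l) w x (n + 1)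
        (Nat.le_of_succ_le h) fun l hl => by rw [if_neg (by omega), one_smul]
      rw [feature, feature, h1]
      ext i
      simp [conv, Finset.smul_sum, mul_smul]

theorem smul_param_mem_neuromanifold (t : ℝ) (w : N.Weights ℝ) :
    t • N.param w ∈ N.neuromanifold :=
  ⟨fun l => (if (l : ℕ) + 1 = N.L then t else 1) • w l, by
    ext1 i
    exact Subtype.ext (congrFun (N.feature_smul_last w _ t N.L le_rfl N.L_pos) i)⟩

theorem param_eq_zero (w : N.Weights ℝ) (l : Fin N.L) (hl : w l = 0) : N.param w = 0 := by
  ext1 i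
  exact Subtype.ext (congrFun (N.feature_eq_zero w _ l hl N.L le_rfl l.2) i)

/-- The neuromanifold is a cone, so membership does not depend on the representative; a non-zero
point comes from filters none of which vanishes. -/
theorem mk_mem_projNeuromanifold_iff (v : N.Ambient) (hv : v ≠ 0) :
    Projectivization.mk ℝ v hv ∈ N.projNeuromanifold ↔ v ∈ N.neuromanifold := by
  constructor
  · rintro ⟨w, hw⟩
    obtain ⟨a, ha⟩ := (Projectivization.mk_eq_mk_iff' ℝ _ _ _ _).1 hw.symm
    rw [← ha]
    exact N.smul_param_mem_neuromanifold _ _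
  · rintro ⟨w, rfl⟩
    exact ⟨_, N.projParam_mk w fun l hl => hv (N.param_eq_zero w l hl)⟩

/-! ### Closedness for non-linear activation -/

/-- For `r > 1`, a point at which all polynomials vanish that vanish on the neuromanifold belongs
to it. -/
theorem mem_neuromanifold_of_eval_eq_zero (hr : 1 < N.r) (p : N.Ambient)
    (hp : ∀ f : MvPolynomial N.CoordIndex ℝ,
      (∀ w, eval (fun x => N.coord x (N.param w)) f = 0) → eval (fun x => N.coord x p) f = 0) :
    p ∈ N.neuromanifold := by
  obtain ⟨κ, _, _, w, c, hw, hpw⟩ := N.exists_extension p hp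
  have hinj : Function.Injective (algebraMap ℝ κ) := (algebraMap ℝ κ).injective
  by_cases hc : c = 0
  · refine ⟨0, ?_⟩
    rw [N.param_eq_zero 0 ⟨0, N.L_pos⟩ rfl]
    ext1 i
    refine Subtype.ext (map_injective _ hinj ?_)
    rw [hpw i, hc, zero_smul]
    exact map_zero _
  have : CharZero κ := charZero_of_injective_algebraMap hinj
  have hmem : c • N.net w (X : Fin (N.d 0) → MvPolynomial (Fin (N.d 0)) κ) ⟨0, N.d_last_pos⟩ ∈
      coeffSubring (Fin (N.d 0)) (algebraMap ℝ κ).fieldRange := fun m => by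
    rw [← hpw, coeff_map]
    exact ⟨_, rfl⟩
  choose e he hew using fun l : Fin N.L =>
    N.exists_smul_weights_mem hr w hw N.L le_rfl _ c hc hmem l l.2
  choose v hv using hew
  obtain ⟨b, hb, hbw⟩ := N.feature_smul_weights w e he
    (X : Fin (N.d 0) → MvPolynomial (Fin (N.d 0)) κ) N.L le_rfl
  have hnet : ∀ i, MvPolynomial.map (algebraMap ℝ κ)
      (N.param v i : MvPolynomial (Fin (N.d 0)) ℝ) = b • N.net w X i := fun i => by
    rw [param, map_net_X]
    simp only [hv]
    exact congrFun hbw i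
  have hpv : ∀ i, MvPolynomial.map (algebraMap ℝ κ) (p i : MvPolynomial (Fin (N.d 0)) ℝ) =
      (c / b) • MvPolynomial.map (algebraMap ℝ κ)
        (N.param v i : MvPolynomial (Fin (N.d 0)) ℝ) := fun i => by
    rw [hpw, hnet, smul_smul, div_mul_cancel₀ _ hb]
  obtain ⟨m, hm⟩ := MvPolynomial.ne_zero_iff.1 (N.net_ne_zero w hw ⟨0, N.d_last_pos⟩)
  have hm' : algebraMap ℝ κ (coeff m (N.param v ⟨0, N.d_last_pos⟩).1) ≠ 0 := by
    rw [← coeff_map, hnet, coeff_smul]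
    exact smul_ne_zero hb hm
  -- The scalar lies a priori in κ, but it relates two real tuples, so a non-zero coefficient shows
  -- that it is real.
  obtain ⟨t, ht⟩ : ∃ t : ℝ, algebraMap ℝ κ t = c / b := by
    refine ⟨coeff m (p ⟨0, N.d_last_pos⟩).1 / coeff m (N.param v ⟨0, N.d_last_pos⟩).1, ?_⟩
    rw [map_div₀, div_eq_iff hm', ← coeff_map, hpv, coeff_smul, coeff_map, smul_eq_mul]
  have hpt : p = t • N.param v := by
    ext1 i
    refine Subtype.ext (map_injective _ hinj ?_)
    rw [hpv, ← ht, Pi.smul_apply, Submodule.coe_smul, smul_eq_C_mul, smul_eq_C_mul, map_mul, map_C]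
  rw [hpt]
  exact N.smul_param_mem_neuromanifold t v

theorem mem_neuromanifold_of_polyValue_eq_zero (hr : 1 < N.r) (v : N.Ambient)
    (h : ∀ p : MvPolynomial (Module.Dual ℝ N.Ambient) ℝ,
      (∀ u ∈ N.neuromanifold, polyValue p u = 0) → polyValue p v = 0) :
    v ∈ N.neuromanifold := by
  refine N.mem_neuromanifold_of_eval_eq_zero hr v fun f hf => ?_
  have hren : ∀ u, polyValue (rename N.coord f) u = eval (fun x => N.coord x u) f := fun u => by
    rw [polyValue, eval_rename]
    rfl
  rw [← hren]
  refine h _ ?_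
  rintro _ ⟨w, rfl⟩
  rw [hren]
  exact hf w

theorem isClosed_neuromanifold (hr : 1 < N.r) :
    IsClosed[affineZariskiTopology ℝ N.Ambient] N.neuromanifold :=
  isClosed_affineZariski_iff.2 ⟨{p | ∀ u ∈ N.neuromanifold, polyValue p u = 0},
    Set.Subset.antisymm (fun _ hv _ hp => hp _ hv)
      fun v hv => N.mem_neuromanifold_of_polyValue_eq_zero hr v hv⟩

/-- The vanishing ideal of a cone over an infinite field contains the homogeneous components of its
elements, so these components are the defining equations. -/
theorem isClosed_projNeuromanifold (hr : 1 < N.r) :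
    IsClosed[projectiveZariskiTopology ℝ N.Ambient] N.projNeuromanifold := by
  refine isClosed_projectiveZariski_iff.2
    ⟨{f | ∃ (n : ℕ) (p : MvPolynomial (Module.Dual ℝ N.Ambient) ℝ),
      (∀ u ∈ N.neuromanifold, polyValue p u = 0) ∧ f = homogeneousComponent n p}, ?_, ?_⟩
  · rintro _ ⟨n, p, -, rfl⟩
    exact ⟨n, homogeneousComponent_isHomogeneous n p⟩
  ext x
  constructor
  · rintro hx v hv rfl _ ⟨n, p, hp, rfl⟩
    obtain ⟨w, rfl⟩ := (N.mk_mem_projNeuromanifold_iff v hv).1 hx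
    exact polyValue_homogeneousComponent_eq_zero
      (fun c => hp _ (N.smul_param_mem_neuromanifold c w)) n
  · intro hx
    rw [← x.mk_rep, mk_mem_projNeuromanifold_iff]
    refine N.mem_neuromanifold_of_polyValue_eq_zero hr _ fun p hp => ?_
    rw [polyValue_eq_sum_homogeneousComponent]
    exact Finset.sum_eq_zero fun n _ =>
      hx _ x.rep_nonzero x.mk_rep.symm _ ⟨n, p, hp, rfl⟩

end PolyCNN

/-! ### A linear network -/

/-- The linear network with two filters of size two, whose neuromanifold consists of the products
of two linear forms. -/
def twoLayerLinear : PolyCNN where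
  L := 2
  k _ := 2
  s _ := 1
  d := ![3, 2, 1]
  r := 1
  L_pos := two_pos
  k_pos _ := two_pos
  s_pos _ := one_pos
  r_pos := one_pos
  d_last_pos := one_pos
  d_eq i := by fin_cases i <;> rfl

namespace twoLayerLinear

theorem net_apply (w : Fin 2 → Fin 2 → ℝ) (x : Fin 3 → ℝ) (i : Fin 1) :
    twoLayerLinear.net (R := ℝ) w x i =
      w 0 0 * w 1 0 * x 0 + (w 0 1 * w 1 0 + w 0 0 * w 1 1) * x 1 + w 0 1 * w 1 1 * x 2 := by
  obtain rfl : i = 0 := Subsingleton.elim _ _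
  have h : twoLayerLinear.net (R := ℝ) w x (0 : Fin 1) =
      ∑ j : Fin 2, w 1 j * (∑ l : Fin 2, w 0 l * x ⟨1 * (1 * 0 + j) + l, by omega⟩) ^ 1 := rfl
  rw [h]
  simp only [Fin.sum_univ_two, pow_one]
  change w 1 0 * (w 0 0 * x 0 + w 0 1 * x 1) + w 1 1 * (w 0 0 * x 1 + w 0 1 * x 2) = _
  ring

theorem eval_param_eq (w : Fin 2 → Fin 2 → ℝ) (x : Fin 3 → ℝ) (i : Fin 1) :
    eval x (twoLayerLinear.param w i).1 =
      w 0 0 * w 1 0 * x 0 + (w 0 1 * w 1 0 + w 0 0 * w 1 1) * x 1 + w 0 1 * w 1 1 * x 2 :=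
  (twoLayerLinear.eval_param w x i).trans (net_apply w x i)

/-- The linear form `x₀ + x₂`. -/
def center : twoLayerLinear.Ambient := fun _ =>
  ⟨X (0 : Fin 3) + X (2 : Fin 3), (isHomogeneous_X ℝ _).add (isHomogeneous_X ℝ _)⟩

/-- The linear form `x₁`. -/
def direction : twoLayerLinear.Ambient := fun _ => ⟨X (1 : Fin 3), isHomogeneous_X ℝ _⟩

theorem eval_center_add (t : ℝ) (x : Fin 3 → ℝ) (i : Fin 1) :
    eval x ((center + t • direction) i).1 = x 0 + x 2 + t * x 1 := by
  have h : eval x (X 0 + X 2 + t • X 1 : MvPolynomial (Fin 3) ℝ) = x 0 + x 2 + t * x 1 := by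
    simp
  exact h

/-- With the linear forms in three variables read as quadratic polynomials in T, this is (1 + bT)(1
+ b⁻¹T) = 1 + (b + b⁻¹)T + T². -/
theorem center_add_mem {b : ℝ} (hb : b ≠ 0) :
    center + (b + b⁻¹) • direction ∈ twoLayerLinear.neuromanifold := by
  refine ⟨(![![1, b], ![1, b⁻¹]] : Fin 2 → Fin 2 → ℝ), ?_⟩
  ext1 i
  refine Subtype.ext (MvPolynomial.funext fun x => ?_)
  have h : ∀ x : Fin 3 → ℝ, 1 * 1 * x 0 + (b * 1 + 1 * b⁻¹) * x 1 + b * b⁻¹ * x 2 =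
      x 0 + x 2 + (b + b⁻¹) * x 1 := fun x => by
    rw [mul_inv_cancel₀ hb]
    ring
  exact (eval_param_eq _ x i).trans ((h x).trans (eval_center_add _ x i).symm)

theorem center_notMem : center ∉ twoLayerLinear.neuromanifold := by
  rintro ⟨w, hw⟩
  obtain ⟨w, rfl⟩ : ∃ v : Fin 2 → Fin 2 → ℝ, v = w := ⟨w, rfl⟩
  have h : ∀ x : Fin 3 → ℝ, x 0 + x 2 + 0 * x 1 =
      w 0 0 * w 1 0 * x 0 + (w 0 1 * w 1 0 + w 0 0 * w 1 1) * x 1 + w 0 1 * w 1 1 * x 2 :=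
    fun x => by
      refine (eval_center_add 0 x 0).symm.trans (Eq.trans ?_ (eval_param_eq w x 0))
      rw [zero_smul, add_zero, hw]
  have h0 := h ![1, 0, 0]
  have h1 := h ![0, 1, 0]
  have h2 := h ![0, 0, 1]
  simp at h0 h1 h2
  -- The two products in the middle coefficient have sum 0 and product 1, so each has square -1.
  have h3 : (w 0 1 * w 1 0) ^ 2 = -1 := by
    linear_combination (w 0 1 * w 1 0) * -h1 + h0 * (w 0 1 * w 1 1) + h2
  nlinarith [sq_nonneg (w 0 1 * w 1 0)]

theorem center_add_ne_zero (t : ℝ) : center + t • direction ≠ 0 := by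
  intro h
  have h1 := eval_center_add t ![1, 0, 0] 0
  rw [h] at h1
  have h2 : eval ![1, 0, 0] ((0 : twoLayerLinear.Ambient) (0 : Fin 1)).1 = (0 : ℝ) := map_zero _
  rw [h2] at h1
  simp at h1

theorem infinite_range_add_inv : (Set.range fun n : ℕ => ((n : ℝ) + 1) + ((n : ℝ) + 1)⁻¹).Infinite := by
  refine Set.infinite_of_not_bddAbove ?_
  rintro ⟨B, hB⟩
  obtain ⟨n, hn⟩ := exists_nat_gt B
  have h1 : ((n : ℝ) + 1) + ((n : ℝ) + 1)⁻¹ ≤ B := hB ⟨n, rfl⟩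
  have h2 : 0 < ((n : ℝ) + 1)⁻¹ := by positivity
  linarith

/-- Polynomials that vanish at the non-zero points of the neuromanifold vanish at `x₀ + x₂`. -/
theorem polyValue_center_eq_zero {p : MvPolynomial (Module.Dual ℝ twoLayerLinear.Ambient) ℝ}
    (hp : ∀ u ∈ twoLayerLinear.neuromanifold, u ≠ 0 → polyValue p u = 0) :
    polyValue p center = 0 := by
  have h := polyValue_eq_zero_of_infinite (p := p) center direction
    (infinite_range_add_inv.mono ?_) 0
  · rwa [zero_smul, add_zero] at h
  · rintro _ ⟨n, rfl⟩
    exact hp _ (center_add_mem (by positivity)) (center_add_ne_zero _)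

theorem not_isClosed_neuromanifold :
    ¬ IsClosed[affineZariskiTopology ℝ twoLayerLinear.Ambient] twoLayerLinear.neuromanifold := by
  intro h
  obtain ⟨P, hP⟩ := isClosed_affineZariski_iff.1 h
  apply center_notMem
  rw [hP]
  intro p hp
  refine polyValue_center_eq_zero fun u hu _ => ?_
  rw [hP] at hu
  exact hu p hp

theorem not_isClosed_projNeuromanifold :
    ¬ IsClosed[projectiveZariskiTopology ℝ twoLayerLinear.Ambient]
      twoLayerLinear.projNeuromanifold := by
  intro h
  obtain ⟨P, hom, hP⟩ := isClosed_projectiveZariski_iff.1 h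
  have hc0 : center ≠ 0 := by simpa using center_add_ne_zero 0
  refine center_notMem ((twoLayerLinear.mk_mem_projNeuromanifold_iff center hc0).1 ?_)
  rw [hP]
  intro v hv hcv p hp
  obtain ⟨a, ha⟩ := (Projectivization.mk_eq_mk_iff' ℝ _ _ _ _).1 hcv.symm
  obtain ⟨n, hn⟩ := hom p hp
  rw [← ha, polyValue_smul hn, polyValue_center_eq_zero, mul_zero]
  intro u hu hu0
  have hmem := (twoLayerLinear.mk_mem_projNeuromanifold_iff u hu0).2 hu
  rw [hP] at hmem
  exact hmem u hu0 rfl p hp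

end twoLayerLinear

end

theorem proposition4p10 :
    (∀ N : PolyCNN, 1 < N.r →
      IsClosed[projectiveZariskiTopology ℝ N.Ambient] N.projNeuromanifold ∧
      IsClosed[affineZariskiTopology ℝ N.Ambient] N.neuromanifold) ∧
    (∃ N : PolyCNN, N.r = 1 ∧
      ¬ IsClosed[projectiveZariskiTopology ℝ N.Ambient] N.projNeuromanifold ∧
      ¬ IsClosed[affineZariskiTopology ℝ N.Ambient] N.neuromanifold) :=
  ⟨fun N hr => ⟨N.isClosed_projNeuromanifold hr, N.isClosed_neuromanifold hr⟩,
    twoLayerLinear, rfl, twoLayerLinear.not_isClosed_projNeuromanifold,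
    twoLayerLinear.not_isClosed_neuromanifold⟩
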